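/- **Theorem.** Let $\alpha,\beta\ge 0$ be integers with $\alpha+\beta\ge 1$, let $m_1,\dots,m_L\in\mathbb{R}^d$, let $C_1,\dots,C_L\in\mathbb{R}^{d\times d}$ be symmetric positive definite, and let $$\phi_\ell(x)=(2\pi)^{-d/2}(\det C_\ell)^{-1/2}\exp\!\left(-\tfrac12(x-m_\ell)^{\top}C_\ell^{-1}(x-m_\ell)\right)$$ be the density of $\mathcal N(m_\ell,C_\ell)$ (a Gaussian radial basis function). Choose indices $i_1,\dots,i_\alpha,j_1,\dots,j_\beta\in\{1,\dots,L\}$, repetitions allowed, and let $s$ run over the list of all $n=\alpha+\beta$ chosen indices, with multiplicity. Put $$C=\Big(\sum_s C_s^{-1}\Big)^{-1},\qquad m=C\sum_s C_s^{-1}m_s,$$ $$Z=(2\pi)^{-\frac{(n-1)d}{2}}\left(\frac{\det C}{\prod_s\det C_s}\right)^{1/2}\exp\!\left(-\tfrac12\Big(\sum_s m_s^{\top}C_s^{-1}m_s-m^{\top}C^{-1}m\Big)\right),$$ and let $X\sim\mathcal N(m,C)$. Then $\prod_{a=1}^{\alpha}\phi_{i_a}(x)\prod_{b=1}^{\beta}\phi_{j_b}(x)=Z\,\Phi(x)$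 for all $x$, where $\Phi$ is the density of $\mathcal N(m,C)$; the tensor moments $M^k=\mathbb E(X^{\otimes k})$ exist for all $k\ge 0$; the tensor-valued integral below converges absolutely; and $$I:=\int_{\mathbb{R}^d}\Big(\prod_{a=1}^{\alpha}\phi_{i_a}(x)\Big)\Big(\bigotimes_{b=1}^{\beta}\nabla\phi_{j_b}(x)\Big)\,dx = Z\sum_{J\subseteq\{1,\dots,\beta\}}(-1)^{\beta-|J|}\Big(\bigotimes_{b=1}^{\beta}C_{j_b}^{-1}\Big)\times_E\Big(\Big(\bigotimes_{r=1}^{|J|}m_{j_{b_r}}\Big)\otimes M^{\beta-|J|}\Big)_{\sigma_J}.$$ Here, for $J=\{b_1<\dots<b_{k}\}$ with complement $\{b_{k+1}<\dots<b_\beta\}$, $\sigma_J$ is the permutation $r\mapsto b_r$, and $T_{\sigma_J}$ is the tensor obtained from $T$ by moving mode $r$ to position $b_r$, i.e. $(T_{\sigma_J})_{p_1,\dots,p_\beta}=T_{p_{b_1},\dots,p_{b_\beta}}$. For a tensor $A$ of order $2\beta$ and a tensor $B$ of order $\beta$, the even-mode contraction is $$(A\times_E B)_{p_1,p_3,\dots,p_{2\beta-1}}=\sum_{p_2,p_4,\dots,p_{2\beta}}A_{p_1,p_2,\dots,p_{2\beta}}B_{p_2,p_4,\dots,p_{2\beta}}.$$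 Moreover, let $C^{1/2}$ be the Cholesky factor of $C$ (lower triangular with positive diagonal, $C^{1/2}(C^{1/2})^{\top}=C$). Then $$I=Z\,\pi^{-d/2}\sum_{k=1}^{N}\omega_k\bigotimes_{b=1}^{\beta}C_{j_b}^{-1}\Big(m_{j_b}-\big(\sqrt2\,C^{1/2}y_k+m\big)\Big)$$ in each of the following cases. 1. $N\ge 1$, and $y_1,\dots,y_N\in\mathbb{R}^d$, $\omega_1,\dots,\omega_N\in\mathbb{R}$ are nodes and weights with $\int_{\mathbb{R}^d}e^{-|x|^2}p(x)\,dx=\sum_{k}\omega_k\,p(y_k)$ for all real polynomials $p$ on $\mathbb{R}^d$ of total degree at most $\beta$. 2. The $y_k$ and $\omega_k$ are the nodes and weights of the tensor-product Gauss–Hermite rule with $q$ points per dimension, for any integer $q$ with $\beta\le 2q-1$. Its nodes are all points of $\mathbb{R}^d$ whose coordinates are zeros of the physicists' Hermite polynomial $H_q$, and the weight of a node is the product over its coordinates of the one-dimensional weights $\int_{\mathbb{R}}e^{-t^2}\ell_\xi(t)\,dt$, where $\ell_\xi$ is the Lagrange basis polynomial, for the zeros of $H_q$, of the zero $\xi$.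 -/

import Mathlib

open scoped Matrix

noncomputable section

namespace GRBF

/-! ### Gaussian radial basis functions and their products -/

/-- Points of `ℝ^d` with the Euclidean norm. -/
abbrev E (d : ℕ) : Type := EuclideanSpace ℝ (Fin d)

/-- A matrix applied to a point of `ℝ^d`. -/
def mulE {d : ℕ} (A : Matrix (Fin d) (Fin d) ℝ) (x : E d) : E d :=
  WithLp.toLp 2 (A *ᵥ x.ofLp)

/-- The quadratic form `xᵀ C⁻¹ x`. -/
def quadInv {d : ℕ} (C : Matrix (Fin d) (Fin d) ℝ) (x : E d) : ℝ :=
  x.ofLp ⬝ᵥ (C⁻¹ *ᵥ x.ofLp)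

/-- The Gaussian radial basis function, that is, the density of `N(m, C)`:
`(2π)^(-d/2) (det C)^(-1/2) exp (-(x - m)ᵀ C⁻¹ (x - m) / 2)`. -/
def gauss {d : ℕ} (m : E d) (C : Matrix (Fin d) (Fin d) ℝ) (x : E d) : ℝ :=
  (2 * Real.pi) ^ (-(d : ℝ) / 2) * C.det ^ (-(1 : ℝ) / 2) *
    Real.exp (-(1 / 2) * quadInv C (x - m))

/-- Covariance of the product Gaussian: the inverse of `∑ s, (C s)⁻¹`. -/
def prodCov {d : ℕ} {ι : Type*} [Fintype ι] (C : ι → Matrix (Fin d) (Fin d) ℝ) :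
    Matrix (Fin d) (Fin d) ℝ :=
  (∑ s, (C s)⁻¹)⁻¹

/-- Mean of the product Gaussian. -/
def prodMean {d : ℕ} {ι : Type*} [Fintype ι] (m : ι → E d)
    (C : ι → Matrix (Fin d) (Fin d) ℝ) : E d :=
  mulE (prodCov C) (∑ s, mulE (C s)⁻¹ (m s))

/-- Normalization constant of the product of the densities of `N(m s, C s)`:
with `n` factors, `C̄ = prodCov C` and `m̄ = prodMean m C` it is
`(2π)^(-(n-1)d/2) (det C̄ / ∏ det C_s)^(1/2)`
`exp (-(∑ m_sᵀ C_s⁻¹ m_s - m̄ᵀ C̄⁻¹ m̄) / 2)`. -/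
def prodConst {d : ℕ} {ι : Type*} [Fintype ι] (m : ι → E d)
    (C : ι → Matrix (Fin d) (Fin d) ℝ) : ℝ :=
  (2 * Real.pi) ^ (-(((Fintype.card ι : ℝ) - 1) * (d : ℝ)) / 2) *
    ((prodCov C).det / ∏ s, (C s).det) ^ ((1 : ℝ) / 2) *
    Real.exp (-(1 / 2) * (∑ s, quadInv (C s) (m s) - quadInv (prodCov C) (prodMean m C)))

/-! ### Tensors, in components -/

/-- Tensors of order `p` all of whose modes have dimension `d`. -/
abbrev Tensor (d p : ℕ) : Type := (Fin p → Fin d) → ℝ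

/-- The outer product `v 0 ⊗ v 1 ⊗ ⋯` of vectors. -/
def outerVec {d p : ℕ} (v : Fin p → E d) : Tensor d p :=
  fun i => ∏ b, v b (i b)

/-- The tensor power `x ⊗ ⋯ ⊗ x` with `k` factors. -/
def tensorPow {d : ℕ} (x : E d) (k : ℕ) : Tensor d k :=
  outerVec fun _ => x

/-- The outer product `A 0 ⊗ A 1 ⊗ ⋯` of matrices, a tensor of order `2 * p`
whose modes number `2 * b` and `2 * b + 1` (counted from `0`) are those of `A b`. -/
def outerMat {d p : ℕ} (A : Fin p → Matrix (Fin d) (Fin d) ℝ) : Tensor d (2 * p) :=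
  fun i => ∏ b : Fin p, A b (i ⟨2 * b.val, by omega⟩) (i ⟨2 * b.val + 1, by omega⟩)

/-- The outer product of two tensors. -/
def tensorMul {d p q : ℕ} (S : Tensor d p) (T : Tensor d q) : Tensor d (p + q) :=
  fun i => S (fun r => i (Fin.castAdd q r)) * T (fun r => i (Fin.natAdd p r))

/-- Merge two multi-indices: with modes counted from `1`, the odd-numbered entries of the
result are those of `a`, and the even-numbered entries are those of `c`. -/
def interleave {d p : ℕ} (a c : Fin p → Fin d) : Fin (2 * p) → Fin d :=
  fun r => if r.val % 2 = 0 then a ⟨r.val / 2, by omega⟩ else c ⟨r.val / 2, by omega⟩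

/-- The even-mode contraction `A ×_E B`: with modes counted from `1`, the even-numbered modes
of `A` are contracted with the modes of `B`. -/
def evenContract {d p : ℕ} (A : Tensor d (2 * p)) (B : Tensor d p) : Tensor d p :=
  fun a => ∑ c : Fin p → Fin d, A (interleave a c) * B c

/-- Permutation of the modes of a tensor: mode `r` of `T` becomes mode `σ r` of the result. -/
def permute {d p q : ℕ} (σ : Fin p ≃ Fin q) (T : Tensor d p) : Tensor d q :=
  fun i => T (fun r => i (σ r))

/-- The permutation `σ_J`: it maps the first `|J|` places increasingly onto the
elements of `J`, and the remaining places increasingly onto the complement of `J`. -/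
def sigma {β : ℕ} (J : Finset (Fin β)) : Fin (J.card + (β - J.card)) ≃ Fin β :=
  finSumFinEquiv.symm.trans
    (finSumEquivOfFinset (s := J) rfl (by rw [Finset.card_compl, Fintype.card_fin]))

/-! ### Cholesky factors -/

/-- `L` is the Cholesky factor of `C`: lower triangular, with positive diagonal, and
`L * Lᵀ = C`. -/
structure IsCholeskyFactor {d : ℕ} (L C : Matrix (Fin d) (Fin d) ℝ) : Prop where
  lower : ∀ r s, r < s → L r s = 0
  diag_pos : ∀ r, 0 < L r r
  mul_transpose : L * Lᵀ = C

/-! ### Gauss–Hermite quadrature -/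

/-- The physicists' Hermite polynomials, orthogonal for the weight `exp (-t ^ 2)`. -/
def physHermite : ℕ → Polynomial ℝ
  | 0 => 1
  | n + 1 => Polynomial.C 2 * Polynomial.X * physHermite n - Polynomial.derivative (physHermite n)

/-- The one-dimensional Gauss–Hermite nodes: the real zeros of the Hermite polynomial
of degree `n`. -/
def ghNodes (n : ℕ) : Finset ℝ := (physHermite n).roots.toFinset

/-- The one-dimensional Gauss–Hermite weight at the node `x`: the integral of
the Lagrange basis polynomial of that node against `exp (-t ^ 2)`. -/
def ghWeight (n : ℕ) (x : ℝ) : ℝ :=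
  ∫ t : ℝ, Real.exp (-t ^ 2) * (Lagrange.basis (ghNodes n) id x).eval t

/-- The nodes of the `d`-dimensional tensor-product Gauss–Hermite rule with `n` points per
dimension. -/
def ghGrid (d n : ℕ) : Finset (Fin d → ℝ) := Fintype.piFinset fun _ => ghNodes n

/-- The weights of the tensor-product Gauss–Hermite rule. -/
def ghGridWeight {d : ℕ} (n : ℕ) (y : Fin d → ℝ) : ℝ := ∏ r, ghWeight n (y r)

/-- The nodes `y` and weights `ω` integrate all real polynomials on `ℝ^d` of total degree at
most `D` exactly against the weight `exp (-|x|²)`. -/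
def IsExactHermiteRule {d N : ℕ} (D : ℕ) (y : Fin N → E d) (ω : Fin N → ℝ) : Prop :=
  ∀ p : MvPolynomial (Fin d) ℝ, p.totalDegree ≤ D →
    ∫ x : E d, Real.exp (-‖x‖ ^ 2) * MvPolynomial.eval x.ofLp p =
      ∑ k, ω k * MvPolynomial.eval (y k).ofLp p

/-! ### The integrals -/

/-- The tensor-valued integrand `(∏ a, φ_{i a}(x)) ⨂ b, ∇φ_{j b}(x)`. -/
def integrand {d L α β : ℕ} (m : Fin L → E d) (C : Fin L → Matrix (Fin d) (Fin d) ℝ)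
    (i : Fin α → Fin L) (j : Fin β → Fin L) (x : E d) : Tensor d β :=
  (∏ a, gauss (m (i a)) (C (i a)) x) •
    outerVec (fun b => gradient (gauss (m (j b)) (C (j b))) x)

/-- The tensor `⨂ b, C_{j b}⁻¹ (m_{j b} - x)`. -/
def polyTensor {d L β : ℕ} (m : Fin L → E d) (C : Fin L → Matrix (Fin d) (Fin d) ℝ)
    (j : Fin β → Fin L) (x : E d) : Tensor d β :=
  outerVec fun b => mulE (C (j b))⁻¹ (m (j b) - x)

end GRBF

end

/-! ### Quadratic forms and Gaussian densities -/

namespace GRBF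

/-! Since `∇φ = φ · C⁻¹(m - x)` (`hasGradientAt_gauss`), the integrand is the product of all `α + β`
densities times the polynomial tensor `⨂ C_{j b}⁻¹(m_{j b} - x)`. Completing the square
(`prod_gauss`) turns the product of densities into `Z` times the density of `N(mbar, Cbar)`, so the
integral is `Z` times the expectation of that tensor under this law.
`multivariateGaussian_eq_withDensity` identifies the density with the Gaussian measure.

The closed form is the multilinear expansion of the tensor over the set `J` of modes that take the
means (`polyTensor_eq_sum`). Contraction is linear, so the expectation passes to the moments.

For the quadrature form, `N(mbar, R Rᵀ)` is the image of the weight `π^(-d/2) exp (-|y|²)` under `y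
↦ √2 R y + mbar` (`map_hermiteMeasure_affine`). Each entry of the tensor becomes a polynomial of
degree at most `β` in `y`, so any rule exact to that degree evaluates it. For the tensor-product
rule, exactness reduces by Fubini on monomials to the classical argument in one variable:
orthogonality, simple real zeros, and division by the Hermite polynomial. -/

theorem mulE_eq_toEuclideanCLM {d : ℕ} (A : Matrix (Fin d) (Fin d) ℝ) (x : E d) :
    mulE A x = Matrix.toEuclideanCLM (𝕜 := ℝ) A x := rfl

theorem quadInv_eq_inner {d : ℕ} (C : Matrix (Fin d) (Fin d) ℝ) (x : E d) :
    quadInv C x = inner ℝ x (Matrix.toEuclideanCLM (𝕜 := ℝ) C⁻¹ x) := by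
  rw [Matrix.inner_toEuclideanCLM]
  simp [quadInv]

theorem inner_toEuclideanCLM_inv_comm {d : ℕ} {C : Matrix (Fin d) (Fin d) ℝ} (hC : C.PosDef)
    (x y : E d) :
    inner ℝ x (Matrix.toEuclideanCLM (𝕜 := ℝ) C⁻¹ y) =
      inner ℝ y (Matrix.toEuclideanCLM (𝕜 := ℝ) C⁻¹ x) := by
  have hT : (C⁻¹)ᵀ = C⁻¹ := by simpa using hC.inv.isHermitian.eq
  rw [Matrix.inner_toEuclideanCLM, Matrix.inner_toEuclideanCLM]
  rw [Matrix.dotProduct_mulVec, ← Matrix.mulVec_transpose, hT, dotProduct_comm]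

/-- Expansion of the square `(x - m)ᵀ C⁻¹ (x - m)`. -/
theorem quadInv_sub {d : ℕ} {C : Matrix (Fin d) (Fin d) ℝ} (hC : C.PosDef) (x m : E d) :
    quadInv C (x - m) = quadInv C x - 2 * inner ℝ x (mulE C⁻¹ m) + quadInv C m := by
  simp only [quadInv_eq_inner, mulE_eq_toEuclideanCLM, map_sub, inner_sub_left, inner_sub_right]
  rw [inner_toEuclideanCLM_inv_comm hC m x]
  ring

section Product

variable {d : ℕ} {ι : Type*} [Fintype ι] {m : ι → E d} {C : ι → Matrix (Fin d) (Fin d) ℝ}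

theorem posDef_sum_inv [Nonempty ι] (hC : ∀ s, (C s).PosDef) : (∑ s, (C s)⁻¹).PosDef :=
  Matrix.posDef_sum Finset.univ_nonempty fun s _ => (hC s).inv

theorem posDef_prodCov [Nonempty ι] (hC : ∀ s, (C s).PosDef) : (prodCov C).PosDef :=
  (posDef_sum_inv hC).inv

theorem prodCov_inv [Nonempty ι] (hC : ∀ s, (C s).PosDef) : (prodCov C)⁻¹ = ∑ s, (C s)⁻¹ :=
  Matrix.nonsing_inv_nonsing_inv _ ((Matrix.isUnit_iff_isUnit_det _).1 (posDef_sum_inv hC).isUnit)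

theorem mulE_prodCov_inv_prodMean [Nonempty ι] (hC : ∀ s, (C s).PosDef) :
    mulE (prodCov C)⁻¹ (prodMean m C) = ∑ s, mulE (C s)⁻¹ (m s) := by
  have h : IsUnit (prodCov C).det :=
    (Matrix.isUnit_iff_isUnit_det _).1 (posDef_prodCov hC).isUnit
  simp only [prodMean, mulE, Matrix.mulVec_mulVec]
  rw [Matrix.nonsing_inv_mul _ h, Matrix.one_mulVec]

/-- Completing the square in a sum of quadratic forms. -/
theorem sum_quadInv_sub [Nonempty ι] (hC : ∀ s, (C s).PosDef) (x : E d) :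
    ∑ s, quadInv (C s) (x - m s) =
      (∑ s, quadInv (C s) (m s) - quadInv (prodCov C) (prodMean m C)) +
        quadInv (prodCov C) (x - prodMean m C) := by
  -- Both sides are expanded around the origin. The quadratic terms agree because the precisions
  -- add, the linear ones because `Cbar⁻¹ mbar = ∑ C_s⁻¹ m_s`.
  rw [quadInv_sub (posDef_prodCov hC), mulE_prodCov_inv_prodMean hC]
  simp only [quadInv_sub (hC _), Finset.sum_add_distrib, Finset.sum_sub_distrib]
  have h1 : quadInv (prodCov C) x = ∑ s, quadInv (C s) x := by
    simp only [quadInv_eq_inner, prodCov_inv hC, map_sum, sum_apply, inner_sum]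
  rw [h1, inner_sum, Finset.mul_sum]
  ring

/-- A product of Gaussian densities is a multiple of a Gaussian density. -/
theorem prod_gauss [Nonempty ι] (hC : ∀ s, (C s).PosDef) (x : E d) :
    ∏ s, gauss (m s) (C s) x = prodConst m C * gauss (prodMean m C) (prodCov C) x := by
  have hdet : ∀ s, 0 < (C s).det := fun s => (hC s).det_pos
  have hD : 0 < (prodCov C).det := (posDef_prodCov hC).det_pos
  have hP : 0 < ∏ s, (C s).det := Finset.prod_pos fun s _ => hdet s
  have hpi : 0 < 2 * Real.pi := by positivity
  simp only [gauss, Finset.prod_mul_distrib, ← Real.exp_sum, ← Finset.mul_sum, prodConst,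
    sum_quadInv_sub hC x, mul_add, Real.exp_add, Finset.prod_const, Finset.card_univ]
  rw [Real.finsetProd_rpow _ _ (fun s _ => (hdet s).le), ← Real.rpow_natCast,
    ← Real.rpow_mul hpi.le, Real.div_rpow hD.le hP.le]
  -- Of the `n` factors `(2π)^(-d/2)`, one normalizes the product Gaussian and `n - 1` go into the
  -- constant.
  have e1 : (2 * Real.pi) ^ (-(d : ℝ) / 2 * (Fintype.card ι : ℝ)) =
      (2 * Real.pi) ^ (-(((Fintype.card ι : ℝ) - 1) * (d : ℝ)) / 2) *
        (2 * Real.pi) ^ (-(d : ℝ) / 2) := by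
    rw [← Real.rpow_add hpi]; congr 1; ring
  have e2 : (prodCov C).det ^ (-(1 : ℝ) / 2) = ((prodCov C).det ^ ((1 : ℝ) / 2))⁻¹ := by
    rw [neg_div, Real.rpow_neg hD.le]
  have e3 : (∏ s, (C s).det) ^ (-(1 : ℝ) / 2) = ((∏ s, (C s).det) ^ ((1 : ℝ) / 2))⁻¹ := by
    rw [neg_div, Real.rpow_neg hP.le]
  have e4 : (prodCov C).det ^ ((1 : ℝ) / 2) ≠ 0 := (Real.rpow_pos_of_pos hD _).ne'
  rw [e1, e2, e3]
  field_simp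

end Product

/-- Symmetry of `A` merges the two terms of the product rule into `2⟨v, A(x - m)⟩`; the `2` cancels
the `1/2`, and the sign turns `x - m` into `m - x`. -/
theorem hasGradientAt_const_mul_exp_quadratic {F : Type*} [NormedAddCommGroup F]
    [InnerProductSpace ℝ F] [CompleteSpace F] (A : F →L[ℝ] F)
    (hA : ∀ x y, inner ℝ x (A y) = inner ℝ y (A x)) (K : ℝ) (m x : F) :
    HasGradientAt (fun y => K * Real.exp (-(1 / 2) * inner ℝ (y - m) (A (y - m))))
      ((K * Real.exp (-(1 / 2) * inner ℝ (x - m) (A (x - m)))) • A (m - x)) x := by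
  rw [hasGradientAt_iff_hasFDerivAt]
  have h1 : HasFDerivAt (fun y : F => y - m) (ContinuousLinearMap.id ℝ F) x :=
    (hasFDerivAt_id x).sub_const m
  have h2 : HasFDerivAt (fun y : F => A (y - m)) (A.comp (ContinuousLinearMap.id ℝ F)) x :=
    A.hasFDerivAt.comp x h1
  refine (((h1.inner ℝ h2).const_mul (-(1 / 2) : ℝ)).exp.const_mul K).congr_fderiv ?_
  ext v
  simp only [smul_apply, ContinuousLinearMap.comp_apply,
    ContinuousLinearMap.prod_apply, fderivInnerCLM_apply, smul_eq_mul,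
    InnerProductSpace.toDual_apply_apply, inner_smul_left, ContinuousLinearMap.id_apply]
  rw [hA (x - m) v, ← neg_sub x m, map_neg, inner_neg_left, real_inner_comm v]
  simp
  ring

/-- The gradient of a Gaussian density. -/
theorem hasGradientAt_gauss {d : ℕ} {C : Matrix (Fin d) (Fin d) ℝ} (hC : C.PosDef) (m x : E d) :
    HasGradientAt (gauss m C) (gauss m C x • mulE C⁻¹ (m - x)) x := by
  have h : gauss m C = fun y => (2 * Real.pi) ^ (-(d : ℝ) / 2) * C.det ^ (-(1 : ℝ) / 2) *
      Real.exp (-(1 / 2) * inner ℝ (y - m) (Matrix.toEuclideanCLM (𝕜 := ℝ) C⁻¹ (y - m))) := by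
    funext y
    rw [gauss, quadInv_eq_inner]
  rw [h, mulE_eq_toEuclideanCLM]
  exact hasGradientAt_const_mul_exp_quadratic _ (inner_toEuclideanCLM_inv_comm hC) _ m x

theorem continuous_gauss {d : ℕ} (m : E d) (C : Matrix (Fin d) (Fin d) ℝ) :
    Continuous (gauss m C) := by
  unfold gauss
  simp only [quadInv_eq_inner]
  fun_prop

theorem gauss_nonneg {d : ℕ} {C : Matrix (Fin d) (Fin d) ℝ} (hC : C.PosDef) (m x : E d) :
    0 ≤ gauss m C x := by
  have := hC.det_pos
  unfold gauss
  positivity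

end GRBF

/-! ### Gaussian measures, their densities and affine images -/

namespace GRBF

open MeasureTheory ProbabilityTheory

theorem integrable_exp_neg_norm_sq (d : ℕ) :
    Integrable (fun y : E d => Real.exp (-‖y‖ ^ 2)) := by
  have h := (GaussianFourier.integrable_cexp_neg_mul_sq_norm_add (V := E d) (b := 1)
    (by simp) 0 0).re
  refine h.congr (.of_forall fun y => ?_)
  simp only [zero_mul, add_zero, neg_mul, one_mul]
  rw [← Complex.ofReal_pow, ← Complex.ofReal_neg, ← Complex.ofReal_exp]
  exact RCLike.ofReal_re _

/-- The probability measure with density `π^(-d/2) exp (-|y|²)`. -/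
noncomputable def hermiteMeasure (d : ℕ) : Measure (E d) :=
  volume.withDensity fun y => ENNReal.ofReal (Real.pi ^ (-(d : ℝ) / 2) * Real.exp (-‖y‖ ^ 2))

instance (d : ℕ) : IsFiniteMeasure (hermiteMeasure d) :=
  isFiniteMeasure_withDensity_ofReal ((integrable_exp_neg_norm_sq d).const_mul _).2

theorem integral_hermiteMeasure {d : ℕ} {F : Type*} [NormedAddCommGroup F] [NormedSpace ℝ F]
    (f : E d → F) :
    ∫ y, f y ∂(hermiteMeasure d) =
      Real.pi ^ (-(d : ℝ) / 2) • ∫ y : E d, Real.exp (-‖y‖ ^ 2) • f y := by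
  rw [hermiteMeasure, integral_withDensity_eq_integral_toReal_smul (by fun_prop)
    (.of_forall fun _ => ENNReal.ofReal_lt_top), ← integral_smul]
  refine integral_congr_ae (.of_forall fun y => ?_)
  simp only [smul_smul]
  rw [ENNReal.toReal_ofReal (by positivity)]

/-- The standard Gaussian measure rescaled to the weight `exp (-|y|²)`. -/
theorem map_hermiteMeasure (d : ℕ) :
    (hermiteMeasure d).map (fun y => Real.sqrt 2 • y) = stdGaussian (E d) := by
  apply Measure.ext_of_charFun
  ext t
  rw [charFun_stdGaussian, charFun_apply, integral_map (by fun_prop)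
    (Continuous.aestronglyMeasurable (by fun_prop)), integral_hermiteMeasure]
  -- The characteristic function is a Gaussian integral with linear coefficient `√2 i`; since `(√2
  -- i)²/4 = -1/2`, it is the standard one.
  have h := GaussianFourier.integral_cexp_neg_mul_sq_norm_add (V := E d) (b := 1)
    (by simp) (Real.sqrt 2 * Complex.I) t
  have e : ∀ y : E d, Real.exp (-‖y‖ ^ 2) •
      Complex.exp (inner ℝ (Real.sqrt 2 • y) t * Complex.I) =
      Complex.exp (-1 * ‖y‖ ^ 2 + Real.sqrt 2 * Complex.I * (inner ℝ t y : ℝ)) := by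
    intro y
    rw [Complex.real_smul, Complex.ofReal_exp, ← Complex.exp_add, real_inner_smul_left,
      real_inner_comm]
    congr 1
    push_cast
    ring
  simp only [e, h]
  have hs : ((Real.sqrt 2 : ℝ) : ℂ) ^ 2 = 2 := by
    rw [← Complex.ofReal_pow, Real.sq_sqrt (by norm_num)]; simp
  rw [mul_pow, hs, Complex.I_sq, div_one, finrank_euclideanSpace_fin, Complex.real_smul,
    ← mul_assoc, Complex.ofReal_cpow Real.pi_pos.le]
  have hp : (Real.pi : ℂ) ≠ 0 := by exact_mod_cast Real.pi_ne_zero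
  push_cast
  rw [← Complex.cpow_add _ _ hp, show -(d : ℂ) / 2 + (d : ℂ) / 2 = 0 by ring, Complex.cpow_zero,
    one_mul]
  congr 1
  ring

/-- The characteristic function sees `R` only through `|Rᵀ t|² = tᵀ R Rᵀ t`, so any factor of the
covariance gives the same law, whether symmetric or triangular. -/
theorem map_stdGaussian_affine {d : ℕ} (m : E d) (R : Matrix (Fin d) (Fin d) ℝ) :
    (stdGaussian (E d)).map (fun y => mulE R y + m) = multivariateGaussian m (R * Rᵀ) := by
  have hc : Continuous fun y : E d => mulE R y + m := by
    simp only [mulE_eq_toEuclideanCLM]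
    fun_prop
  have hps : (R * Rᵀ).PosSemidef := by
    simpa using Matrix.posSemidef_self_mul_conjTranspose R
  have := Measure.isProbabilityMeasure_map (μ := stdGaussian (E d)) hc.aemeasurable
  apply Measure.ext_of_charFun
  ext t
  rw [charFun_multivariateGaussian hps, charFun_apply, integral_map hc.aemeasurable
    (Continuous.aestronglyMeasurable (by fun_prop))]
  have e : ∀ y : E d, Complex.exp (inner ℝ (mulE R y + m) t * Complex.I) =
      Complex.exp (inner ℝ y (mulE Rᵀ t) * Complex.I) * Complex.exp (inner ℝ t m * Complex.I) := by
    intro y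
    rw [← Complex.exp_add, inner_add_left, real_inner_comm t m]
    have : inner ℝ (mulE R y) t = inner ℝ y (mulE Rᵀ t) := by
      rw [real_inner_comm, mulE_eq_toEuclideanCLM, mulE_eq_toEuclideanCLM,
        Matrix.inner_toEuclideanCLM, Matrix.inner_toEuclideanCLM, Matrix.dotProduct_mulVec,
        ← Matrix.mulVec_transpose, dotProduct_comm]
    rw [this]
    push_cast
    ring_nf
  simp only [e]
  rw [integral_mul_const, ← charFun_apply, charFun_stdGaussian, ← Complex.exp_add]
  have hn : ‖mulE Rᵀ t‖ ^ 2 = t.ofLp ⬝ᵥ (R * Rᵀ) *ᵥ t.ofLp := by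
    rw [EuclideanSpace.real_norm_sq_eq, ← Matrix.mulVec_mulVec, Matrix.dotProduct_mulVec,
      ← Matrix.mulVec_transpose]
    simp [mulE, dotProduct, sq]
  rw [← Complex.ofReal_pow, hn]
  congr 1
  ring

/-- Every factor `R` with `R Rᵀ = C` realizes `N(m, C)` as an affine image of the weight
`exp (-|y|²)`. -/
theorem map_hermiteMeasure_affine {d : ℕ} (m : E d) (R : Matrix (Fin d) (Fin d) ℝ) :
    (hermiteMeasure d).map (fun y => Real.sqrt 2 • mulE R y + m) =
      multivariateGaussian m (R * Rᵀ) := by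
  have hc : Continuous fun y : E d => mulE R y + m := by
    simp only [mulE_eq_toEuclideanCLM]
    fun_prop
  rw [← map_stdGaussian_affine, ← map_hermiteMeasure, Measure.map_map hc.measurable (by fun_prop)]
  congr 1
  funext y
  simp [mulE_eq_toEuclideanCLM]

theorem exists_mul_transpose_eq {d : ℕ} {C : Matrix (Fin d) (Fin d) ℝ} (hC : C.PosDef) :
    ∃ R : Matrix (Fin d) (Fin d) ℝ, R * Rᵀ = C := by
  open scoped MatrixOrder in
  refine ⟨CFC.sqrt C, ?_⟩
  have h : (CFC.sqrt C)ᵀ = CFC.sqrt C := by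
    have := (CFC.sqrt_nonneg C).isSelfAdjoint.star_eq
    rwa [Matrix.star_eq_conjTranspose, Matrix.conjTranspose_eq_transpose_of_trivial] at this
  rw [h, CFC.sqrt_mul_sqrt_self _ hC.posSemidef.nonneg]

/-- The Jacobian `2^(d/2) |det R|` of `y ↦ √2 R y + m` cancels the matching part of the
normalization, and the quadratic form becomes `2|y|²`. -/
theorem gauss_affine {d : ℕ} (m : E d) {R : Matrix (Fin d) (Fin d) ℝ} (hR : R.det ≠ 0) (y : E d) :
    |(Real.sqrt 2 • Matrix.toEuclideanCLM (𝕜 := ℝ) R).det| *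
        gauss m (R * Rᵀ) (Real.sqrt 2 • mulE R y + m) =
      Real.pi ^ (-(d : ℝ) / 2) * Real.exp (-‖y‖ ^ 2) := by
  have hdet : (Matrix.toEuclideanCLM (𝕜 := ℝ) R).det = R.det := by
    rw [ContinuousLinearMap.det, Matrix.coe_toEuclideanCLM_eq_toEuclideanLin]
    rw [Matrix.toEuclideanLin, Matrix.toLpLin_eq_toLin, LinearMap.det_toLin]
  have hsdet : (Real.sqrt 2 • Matrix.toEuclideanCLM (𝕜 := ℝ) R).det =
      Real.sqrt 2 ^ d * R.det := by
    rw [← hdet]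
    simp [ContinuousLinearMap.det, LinearMap.det_smul]
  have hq : quadInv (R * Rᵀ) (Real.sqrt 2 • mulE R y) = 2 * ‖y‖ ^ 2 := by
    have hu : IsUnit R.det := hR.isUnit
    have hut : IsUnit Rᵀ.det := by rwa [Matrix.det_transpose]
    have h1 : (R * Rᵀ)⁻¹ *ᵥ (R *ᵥ y.ofLp) = Rᵀ⁻¹ *ᵥ y.ofLp := by
      rw [Matrix.mul_inv_rev, Matrix.mulVec_mulVec, Matrix.mul_assoc, Matrix.nonsing_inv_mul _ hu,
        Matrix.mul_one]
    simp only [quadInv, mulE, WithLp.ofLp_smul, Matrix.mulVec_smul, h1, smul_dotProduct,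
      dotProduct_smul, smul_eq_mul]
    rw [← mul_assoc, Real.mul_self_sqrt (by norm_num), dotProduct_comm, Matrix.dotProduct_mulVec,
      ← Matrix.mulVec_transpose, Matrix.mulVec_mulVec, Matrix.mul_nonsing_inv _ hut,
      Matrix.one_mulVec, EuclideanSpace.real_norm_sq_eq]
    simp [dotProduct, sq]
  have hd2 : (R * Rᵀ).det ^ (-(1 : ℝ) / 2) = |R.det|⁻¹ := by
    rw [Matrix.det_mul, Matrix.det_transpose, neg_div, Real.rpow_neg (mul_self_nonneg _),
      ← Real.sqrt_eq_rpow, Real.sqrt_mul_self_eq_abs]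
  have h2 : Real.sqrt 2 ^ d * (2 : ℝ) ^ (-(d : ℝ) / 2) = 1 := by
    rw [← Real.rpow_natCast, Real.sqrt_eq_rpow, ← Real.rpow_mul (by norm_num),
      ← Real.rpow_add (by norm_num)]
    ring_nf
    simp
  rw [gauss, add_sub_cancel_right, hq, hsdet, hd2, abs_mul, abs_of_nonneg (by positivity),
    Real.mul_rpow (by norm_num) Real.pi_pos.le]
  have hRa : |R.det| ≠ 0 := abs_ne_zero.2 hR
  rw [show -(1 / 2) * (2 * ‖y‖ ^ 2) = -‖y‖ ^ 2 by ring]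
  calc _ = (Real.sqrt 2 ^ d * (2 : ℝ) ^ (-(d : ℝ) / 2)) * (|R.det| * |R.det|⁻¹) *
      (Real.pi ^ (-(d : ℝ) / 2) * Real.exp (-‖y‖ ^ 2)) := by ring
    _ = _ := by rw [h2, mul_inv_cancel₀ hRa]; ring

/-- `gauss m C` is the density of `N(m, C)`. -/
theorem multivariateGaussian_eq_withDensity {d : ℕ} (m : E d) {C : Matrix (Fin d) (Fin d) ℝ}
    (hC : C.PosDef) :
    multivariateGaussian m C = volume.withDensity fun x => ENNReal.ofReal (gauss m C x) := by
  obtain ⟨R, rfl⟩ := exists_mul_transpose_eq hC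
  have hR : R.det ≠ 0 := by
    have := hC.det_pos
    rw [Matrix.det_mul, Matrix.det_transpose] at this
    exact fun h => by simp [h] at this
  set T : E d → E d := fun y => Real.sqrt 2 • mulE R y + m with hT
  have hcont : Continuous T := by
    simp only [hT, mulE_eq_toEuclideanCLM]
    fun_prop
  have hu : IsUnit R.det := hR.isUnit
  have hs2 : Real.sqrt 2 ≠ 0 := by positivity
  have hinj : Function.Injective T := by
    intro x y h
    have h1 : mulE R x = mulE R y := smul_right_injective _ hs2 (add_right_cancel h)
    have h2 := congrArg (mulE R⁻¹) h1
    simpa [mulE, Matrix.mulVec_mulVec, Matrix.nonsing_inv_mul _ hu] using h2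
  have hsurj : Function.Surjective T := by
    intro x
    refine ⟨(Real.sqrt 2)⁻¹ • mulE R⁻¹ (x - m), ?_⟩
    have h1 : mulE R (mulE R⁻¹ (x - m)) = x - m := by
      simp [mulE, Matrix.mulVec_mulVec, Matrix.mul_nonsing_inv _ hu]
    have h2 : mulE R ((Real.sqrt 2)⁻¹ • mulE R⁻¹ (x - m)) =
        (Real.sqrt 2)⁻¹ • mulE R (mulE R⁻¹ (x - m)) := by
      simp only [mulE_eq_toEuclideanCLM, map_smul]
    simp only [hT, h2, h1, smul_smul, mul_inv_cancel₀ hs2, one_smul, sub_add_cancel]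
  have hder : ∀ y, HasFDerivAt T (Real.sqrt 2 • Matrix.toEuclideanCLM (𝕜 := ℝ) R) y := fun y =>
    ((Matrix.toEuclideanCLM (𝕜 := ℝ) R).hasFDerivAt.const_smul (Real.sqrt 2)).add_const m
  rw [← map_hermiteMeasure_affine]
  ext s hs
  have hpre : MeasurableSet (T ⁻¹' s) := hcont.measurable hs
  rw [Measure.map_apply hcont.measurable hs, hermiteMeasure, withDensity_apply _ hpre,
    withDensity_apply _ hs]
  -- Change of variables needs the domain as an image of `T`.
  conv_rhs => rw [← Set.image_preimage_eq s hsurj]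
  rw [lintegral_image_eq_lintegral_abs_det_fderiv_mul volume hpre
    (fun y _ => (hder y).hasFDerivWithinAt) hinj.injOn]
  refine lintegral_congr fun y => ?_
  rw [← ENNReal.ofReal_mul (abs_nonneg _), gauss_affine m hR y]

theorem integrable_multivariateGaussian_iff {d : ℕ} (m : E d) {C : Matrix (Fin d) (Fin d) ℝ}
    (hC : C.PosDef) {F : Type*} [NormedAddCommGroup F] [NormedSpace ℝ F] {f : E d → F} :
    Integrable f (multivariateGaussian m C) ↔ Integrable fun x => gauss m C x • f x := by
  have hg := (continuous_gauss m C).measurable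
  rw [multivariateGaussian_eq_withDensity m hC, integrable_withDensity_iff_integrable_smul'
    (by fun_prop) (.of_forall fun _ => ENNReal.ofReal_lt_top)]
  simp only [ENNReal.toReal_ofReal (gauss_nonneg hC m _)]

theorem integral_multivariateGaussian {d : ℕ} (m : E d) {C : Matrix (Fin d) (Fin d) ℝ}
    (hC : C.PosDef) {F : Type*} [NormedAddCommGroup F] [NormedSpace ℝ F] (f : E d → F) :
    ∫ x, f x ∂(multivariateGaussian m C) = ∫ x, gauss m C x • f x := by
  have hg := (continuous_gauss m C).measurable
  rw [multivariateGaussian_eq_withDensity m hC, integral_withDensity_eq_integral_toReal_smul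
    (by fun_prop) (.of_forall fun _ => ENNReal.ofReal_lt_top)]
  simp only [ENNReal.toReal_ofReal (gauss_nonneg hC m _)]

end GRBF

/-! ### Polynomial functions and the polynomial tensor -/

namespace GRBF

open MeasureTheory ProbabilityTheory

/-- Real polynomial functions on `ℝ^d` of total degree at most `n`. -/
def IsPolyFun {d : ℕ} (n : ℕ) (f : E d → ℝ) : Prop :=
  ∃ p : MvPolynomial (Fin d) ℝ, p.totalDegree ≤ n ∧ ∀ x : E d, MvPolynomial.eval x.ofLp p = f x

namespace IsPolyFun

variable {d : ℕ}

theorem const (n : ℕ) (a : ℝ) : IsPolyFun n (fun _ : E d => a) :=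
  ⟨MvPolynomial.C a, by simp, by simp⟩

theorem coord {n : ℕ} (hn : 1 ≤ n) (r : Fin d) : IsPolyFun n (fun x : E d => x r) :=
  ⟨MvPolynomial.X r, by simpa using hn, by simp⟩

theorem mul {k n : ℕ} {f g : E d → ℝ} (hf : IsPolyFun k f) (hg : IsPolyFun n g) :
    IsPolyFun (k + n) (fun x => f x * g x) := by
  obtain ⟨p, hp, hpf⟩ := hf
  obtain ⟨q, hq, hqg⟩ := hg
  exact ⟨p * q, (MvPolynomial.totalDegree_mul p q).trans (by omega), fun x => by simp [hpf, hqg]⟩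

theorem const_mul {n : ℕ} {f : E d → ℝ} (a : ℝ) (hf : IsPolyFun n f) :
    IsPolyFun n (fun x => a * f x) := by
  simpa using (const 0 a).mul hf

theorem sub {n : ℕ} {f g : E d → ℝ} (hf : IsPolyFun n f) (hg : IsPolyFun n g) :
    IsPolyFun n (fun x => f x - g x) := by
  obtain ⟨p, hp, hpf⟩ := hf
  obtain ⟨q, hq, hqg⟩ := hg
  exact ⟨p - q, (MvPolynomial.totalDegree_sub p q).trans (max_le hp hq),
    fun x => by simp [hpf, hqg]⟩

theorem add {n : ℕ} {f g : E d → ℝ} (hf : IsPolyFun n f) (hg : IsPolyFun n g) :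
    IsPolyFun n (fun x => f x + g x) := by
  simpa using hf.sub (hg.const_mul (-1))

theorem sum {n : ℕ} {ι : Type*} (s : Finset ι) {f : ι → E d → ℝ}
    (hf : ∀ i, IsPolyFun n (f i)) : IsPolyFun n (fun x => ∑ i ∈ s, f i x) := by
  classical
  induction s using Finset.induction_on with
  | empty => simpa using const n 0
  | insert a s ha ih => simpa [Finset.sum_insert ha] using (hf a).add ih

theorem prod {ι : Type*} (s : Finset ι) {f : ι → E d → ℝ}
    (hf : ∀ i, IsPolyFun 1 (f i)) : IsPolyFun s.card (fun x => ∏ i ∈ s, f i x) := by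
  classical
  induction s using Finset.induction_on with
  | empty => simpa using const 0 1
  | insert a s ha ih =>
    rw [Finset.card_insert_of_notMem ha, add_comm]
    simpa [Finset.prod_insert ha] using (hf a).mul ih

/-- Polynomials are integrable for Gaussian measures. -/
theorem integrable {n : ℕ} {f : E d → ℝ} (hf : IsPolyFun n f) (μ : Measure (E d)) [IsGaussian μ] :
    Integrable f μ := by
  obtain ⟨p, -, hp⟩ := hf
  have : f = fun x : E d => ∑ s ∈ p.support, p.coeff s * ∏ i, x i ^ s i := by
    funext x
    rw [← hp, MvPolynomial.eval_eq']
  rw [this]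
  refine integrable_finsetSum _ fun s _ => Integrable.const_mul ?_ _
  -- A monomial is bounded by the power of the norm with its total exponent, and Gaussian measures
  -- have all moments. Exponent zero is treated separately since `integrable_norm_pow` wants a
  -- nonzero one.
  have hm : Integrable (fun x : E d => ‖x‖ ^ ∑ i, s i) μ := by
    rcases eq_or_ne (∑ i, s i) 0 with h | h
    · simp [h]
    · exact (IsGaussian.memLp_id μ _ (by simp)).integrable_norm_pow h
  refine hm.mono (by fun_prop) (.of_forall fun x => ?_)
  rw [norm_prod, norm_pow, norm_norm, ← Finset.prod_pow_eq_pow_sum]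
  refine Finset.prod_le_prod (fun _ _ => by positivity) fun i _ => ?_
  rw [norm_pow]
  exact pow_le_pow_left₀ (norm_nonneg _) (PiLp.norm_apply_le x i) _

theorem mulE_coord {f : E d → E d} (A : Matrix (Fin d) (Fin d) ℝ)
    (hf : ∀ r, IsPolyFun 1 (fun x => f x r)) (r : Fin d) :
    IsPolyFun 1 (fun x => mulE A (f x) r) := by
  simp only [mulE, Matrix.mulVec, dotProduct]
  exact sum _ fun e => (hf e).const_mul _

end IsPolyFun

theorem isPolyFun_tensorPow {d : ℕ} (k : ℕ) (a : Fin k → Fin d) :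
    IsPolyFun k (fun x => tensorPow x k a) := by
  simpa [tensorPow, outerVec] using IsPolyFun.prod Finset.univ fun b => IsPolyFun.coord le_rfl (a b)

/-- Each entry is a product of `β` affine functions. The inner map `f` covers both the identity and
the quadrature substitution. -/
theorem isPolyFun_polyTensor_comp {d L β : ℕ} (m : Fin L → E d)
    (C : Fin L → Matrix (Fin d) (Fin d) ℝ) (j : Fin β → Fin L) {f : E d → E d}
    (hf : ∀ r, IsPolyFun 1 (fun x => f x r)) (a : Fin β → Fin d) :
    IsPolyFun β (fun x => polyTensor m C j (f x) a) := by
  have h : ∀ b, IsPolyFun 1 fun x => mulE (C (j b))⁻¹ (m (j b) - f x) (a b) := fun b =>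
    IsPolyFun.mulE_coord _ (fun r => (IsPolyFun.const 1 (m (j b) r)).sub (hf r)) (a b)
  simpa [polyTensor, outerVec] using IsPolyFun.prod Finset.univ h

theorem integrable_polyTensor {d L β : ℕ} (m : Fin L → E d)
    (C : Fin L → Matrix (Fin d) (Fin d) ℝ) (j : Fin β → Fin L) (μ : Measure (E d)) [IsGaussian μ] :
    Integrable (polyTensor m C j) μ :=
  .of_eval fun a => (isPolyFun_polyTensor_comp m C j (IsPolyFun.coord le_rfl) a).integrable μ

theorem integrable_tensorPow {d : ℕ} (k : ℕ) (μ : Measure (E d)) [IsGaussian μ] :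
    Integrable (fun x => tensorPow x k) μ :=
  .of_eval fun a => (isPolyFun_tensorPow k a).integrable μ

/-- The product of all chosen Gaussian densities is `Z` times the density of `N(m, C)`. -/
theorem prod_mul_prod_gauss {d L α β : ℕ} (hαβ : 0 < α + β) (m : Fin L → E d)
    (C : Fin L → Matrix (Fin d) (Fin d) ℝ) (hC : ∀ l, (C l).PosDef)
    (i : Fin α → Fin L) (j : Fin β → Fin L) (x : E d) :
    (∏ a, gauss (m (i a)) (C (i a)) x) * (∏ b, gauss (m (j b)) (C (j b)) x) =
      prodConst (fun s => m (Sum.elim i j s)) (fun s => C (Sum.elim i j s)) *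
        gauss (prodMean (fun s => m (Sum.elim i j s)) (fun s => C (Sum.elim i j s)))
          (prodCov (fun s => C (Sum.elim i j s))) x := by
  have : Nonempty (Fin α ⊕ Fin β) := by
    rw [← Fintype.card_pos_iff]
    simpa using hαβ
  rw [← prod_gauss fun s => hC _, Fintype.prod_sum_type]
  rfl

theorem integrand_eq_smul_polyTensor {d L α β : ℕ} (m : Fin L → E d)
    (C : Fin L → Matrix (Fin d) (Fin d) ℝ) (hC : ∀ l, (C l).PosDef)
    (i : Fin α → Fin L) (j : Fin β → Fin L) (x : E d) :
    integrand m C i j x =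
      ((∏ a, gauss (m (i a)) (C (i a)) x) * ∏ b, gauss (m (j b)) (C (j b)) x) •
        polyTensor m C j x := by
  funext a
  simp only [integrand, polyTensor, outerVec, Pi.smul_apply, smul_eq_mul, mul_assoc,
    ← Finset.prod_mul_distrib]
  congr 1
  refine Finset.prod_congr rfl fun b _ => ?_
  rw [(hasGradientAt_gauss (hC (j b)) (m (j b)) x).gradient]
  rfl

theorem outerMat_interleave {d p : ℕ} (A : Fin p → Matrix (Fin d) (Fin d) ℝ)
    (a c : Fin p → Fin d) : outerMat A (interleave a c) = ∏ b, A b (a b) (c b) := by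
  refine Finset.prod_congr rfl fun b _ => ?_
  simp only [interleave]
  have h1 : 2 * b.val % 2 = 0 := by omega
  have h3 : (2 * b.val + 1) / 2 = b.val := by omega
  simp [h1, h3]

/-- The increasing enumerations of `J` and `Jᶜ` only reindex two products, so `sigma` disappears
from the entries. -/
theorem permute_sigma_tensorMul {d β : ℕ} (J : Finset (Fin β)) (v : Fin β → E d) (x : E d)
    (c : Fin β → Fin d) :
    permute (sigma J) (tensorMul (outerVec fun r : Fin J.card => v (J.orderEmbOfFin rfl r))
      (tensorPow x (β - J.card))) c = (∏ b ∈ J, v b (c b)) * ∏ b ∈ Jᶜ, x (c b) := by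
  have hcard : Jᶜ.card = β - J.card := by rw [Finset.card_compl, Fintype.card_fin]
  simp only [permute, tensorMul, outerVec, tensorPow, sigma, Equiv.trans_apply,
    finSumFinEquiv_symm_apply_castAdd, finSumFinEquiv_symm_apply_natAdd,
    finSumEquivOfFinset_inl, finSumEquivOfFinset_inr]
  congr 1
  · conv_rhs => rw [← Finset.map_orderEmbOfFin_univ J rfl, Finset.prod_map]
    rfl
  · conv_rhs => rw [← Finset.map_orderEmbOfFin_univ Jᶜ hcard, Finset.prod_map]
    rfl

/-- The multilinear expansion of `⨂ b, C_{j b}⁻¹ (m_{j b} - x)`. -/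
theorem polyTensor_eq_sum {d L β : ℕ} (m : Fin L → E d)
    (C : Fin L → Matrix (Fin d) (Fin d) ℝ) (j : Fin β → Fin L) (x : E d) :
    polyTensor m C j x = ∑ J : Finset (Fin β), (-1 : ℝ) ^ (β - J.card) •
      evenContract (outerMat fun b => (C (j b))⁻¹)
        (permute (sigma J)
          (tensorMul (outerVec fun r : Fin J.card => m (j (J.orderEmbOfFin rfl r)))
            (tensorPow x (β - J.card)))) := by
  funext a
  have hsub : ∀ c : Fin β → Fin d, ∏ b, (m (j b) (c b) - x (c b)) =
      ∑ J : Finset (Fin β), (-1 : ℝ) ^ (β - J.card) *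
        ((∏ b ∈ J, m (j b) (c b)) * ∏ b ∈ Jᶜ, x (c b)) := by
    intro c
    -- Here `J` collects the modes where the mean is chosen; each mode of `Jᶜ` contributes one sign.
    simp only [sub_eq_add_neg, Finset.prod_add, Finset.powerset_univ, Finset.prod_neg,
      ← Finset.compl_eq_univ_sdiff, Finset.card_compl, Fintype.card_fin]
    exact Finset.sum_congr rfl fun J _ => by ring
  simp only [Finset.sum_apply, Pi.smul_apply, smul_eq_mul, evenContract, outerMat_interleave,
    permute_sigma_tensorMul _ (fun b => m (j b))]
  simp only [Finset.mul_sum]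
  rw [Finset.sum_comm]
  have : polyTensor m C j x a =
      ∑ c : Fin β → Fin d, ∏ b, ((C (j b))⁻¹ (a b) (c b) * (m (j b) (c b) - x (c b))) := by
    have h := Finset.prod_univ_sum (fun _ : Fin β => (Finset.univ : Finset (Fin d)))
      fun b e => (C (j b))⁻¹ (a b) e * (m (j b) e - x e)
    rw [Fintype.piFinset_univ] at h
    exact h
  rw [this]
  refine Finset.sum_congr rfl fun c _ => ?_
  rw [Finset.prod_mul_distrib, hsub, Finset.mul_sum]
  exact Finset.sum_congr rfl fun J _ => by ring

/-- The even-mode contraction of a fixed tensor with a fixed outer factor and permutation of modes,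
as a linear map in the remaining factor. -/
def contractLinear {d p q β : ℕ} (A : Tensor d (2 * β)) (σ : Fin (p + q) ≃ Fin β)
    (S : Tensor d p) : Tensor d q →ₗ[ℝ] Tensor d β where
  toFun T := evenContract A (permute σ (tensorMul S T))
  map_add' T U := by
    funext a
    simp [evenContract, permute, tensorMul, mul_add, Finset.sum_add_distrib]
  map_smul' r T := by
    funext a
    simp only [evenContract, permute, tensorMul, Pi.smul_apply, smul_eq_mul, RingHom.id_apply,
      Finset.mul_sum]
    exact Finset.sum_congr rfl fun c _ => by ring

/-- Each term of the expansion is linear in the tensor power; in finite dimension it is therefore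
continuous and commutes with the integral. -/
theorem integral_polyTensor {d L β : ℕ} (m : Fin L → E d)
    (C : Fin L → Matrix (Fin d) (Fin d) ℝ) (j : Fin β → Fin L) (μ : Measure (E d)) [IsGaussian μ] :
    ∫ x, polyTensor m C j x ∂μ = ∑ J : Finset (Fin β), (-1 : ℝ) ^ (β - J.card) •
      evenContract (outerMat fun b => (C (j b))⁻¹)
        (permute (sigma J)
          (tensorMul (outerVec fun r : Fin J.card => m (j (J.orderEmbOfFin rfl r)))
            (∫ x, tensorPow x (β - J.card) ∂μ))) := by
  let Λ : (J : Finset (Fin β)) → Tensor d (β - J.card) →L[ℝ] Tensor d β := fun J =>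
    (contractLinear (outerMat fun b => (C (j b))⁻¹) (sigma J)
      (outerVec fun r : Fin J.card => m (j (J.orderEmbOfFin rfl r)))).toContinuousLinearMap
  have h : ∀ x, polyTensor m C j x =
      ∑ J : Finset (Fin β), (-1 : ℝ) ^ (β - J.card) • Λ J (tensorPow x (β - J.card)) :=
    polyTensor_eq_sum m C j
  have hi : ∀ J, Integrable (fun x => Λ J (tensorPow x (β - J.card))) μ := fun J =>
    (Λ J).integrable_comp (integrable_tensorPow _ μ)
  simp only [h]
  rw [integral_finsetSum _ fun J _ => (hi J).fun_smul _]
  refine Finset.sum_congr rfl fun J _ => ?_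
  rw [integral_smul, (Λ J).integral_comp_comm (integrable_tensorPow _ μ)]
  rfl

/-- A quadrature rule for the weight `exp (-|x|²)` that is exact up to degree `β` integrates
the polynomial tensor exactly against `N(μ, R Rᵀ)`. -/
theorem integral_polyTensor_eq_quadrature {d L β : ℕ} (m : Fin L → E d)
    (C : Fin L → Matrix (Fin d) (Fin d) ℝ) (j : Fin β → Fin L) (mbar : E d)
    (R : Matrix (Fin d) (Fin d) ℝ) {κ : Type*} (s : Finset κ) (y : κ → E d) (ω : κ → ℝ)
    (h : ∀ p : MvPolynomial (Fin d) ℝ, p.totalDegree ≤ β →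
      ∫ x : E d, Real.exp (-‖x‖ ^ 2) * MvPolynomial.eval x.ofLp p =
        ∑ k ∈ s, ω k * MvPolynomial.eval (y k).ofLp p) :
    ∫ x, polyTensor m C j x ∂(multivariateGaussian mbar (R * Rᵀ)) =
      Real.pi ^ (-(d : ℝ) / 2) • ∑ k ∈ s, ω k •
        polyTensor m C j (Real.sqrt 2 • mulE R (y k) + mbar) := by
  have hint := integrable_polyTensor m C j (multivariateGaussian mbar (R * Rᵀ))
  funext a
  rw [eval_integral (fun a => hint.eval a)]
  have hT : Continuous fun x : E d => Real.sqrt 2 • mulE R x + mbar := by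
    simp only [mulE_eq_toEuclideanCLM]
    fun_prop
  have hpc : AEStronglyMeasurable (fun x => polyTensor m C j x a)
      (multivariateGaussian mbar (R * Rᵀ)) := (hint.eval a).1
  -- Pulling back to the weight `exp (-|y|²)` makes the entry a polynomial of degree at most `β` in
  -- `y`.
  rw [← map_hermiteMeasure_affine] at hpc ⊢
  rw [integral_map hT.aemeasurable hpc, integral_hermiteMeasure]
  have haff : ∀ r, IsPolyFun 1 fun x : E d => (Real.sqrt 2 • mulE R x + mbar) r := fun r =>
    ((IsPolyFun.mulE_coord R (IsPolyFun.coord le_rfl) r).const_mul _).add (IsPolyFun.const _ _)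
  obtain ⟨p, hp, hpe⟩ := isPolyFun_polyTensor_comp m C j haff a
  have := h p hp
  simp only [hpe] at this
  simp only [smul_eq_mul, Pi.smul_apply, Finset.sum_apply, this]

end GRBF

/-! ### Hermite polynomials and Gauss–Hermite quadrature -/

namespace GRBF

open MeasureTheory Polynomial

theorem physHermite_succ (n : ℕ) :
    physHermite (n + 1) = C 2 * X * physHermite n - derivative (physHermite n) := rfl

theorem degree_physHermite (n : ℕ) : (physHermite n).degree = n := by
  induction n with
  | zero => simp [physHermite]
  | succ n ih =>
    have h0 : physHermite n ≠ 0 := by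
      intro h
      simp [h] at ih
    have h1 : (C 2 * X * physHermite n : ℝ[X]).degree = (n + 1 : ℕ) := by
      rw [degree_mul, degree_C_mul_X (by norm_num), ih, add_comm]
      rfl
    have h2 : (derivative (physHermite n)).degree < (C 2 * X * physHermite n : ℝ[X]).degree := by
      refine (degree_derivative_lt h0).trans ?_
      rw [ih, h1]
      exact_mod_cast n.lt_succ_self
    rw [physHermite_succ, degree_sub_eq_left_of_degree_lt h2, h1]

theorem physHermite_ne_zero (n : ℕ) : physHermite n ≠ 0 := by
  intro h
  simpa [h] using degree_physHermite n

theorem derivative_physHermite_succ (n : ℕ) :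
    derivative (physHermite (n + 1)) = C (2 * (n + 1) : ℝ) * physHermite n := by
  induction n with
  | zero => simp [physHermite]
  | succ n ih =>
    have h : derivative (physHermite (n + 2)) = C 2 * physHermite (n + 1) +
        C 2 * X * derivative (physHermite (n + 1)) -
          derivative (derivative (physHermite (n + 1))) := by
      rw [physHermite_succ (n + 1)]
      simp only [derivative_sub, derivative_mul, derivative_C, derivative_X]
      ring
    rw [h, ih, derivative_C_mul]
    have e : C 2 * X * (C (2 * (n + 1) : ℝ) * physHermite n) -
        C (2 * (n + 1) : ℝ) * derivative (physHermite n) =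
        C (2 * (n + 1) : ℝ) * physHermite (n + 1) := by
      rw [physHermite_succ n]
      ring
    rw [add_sub_assoc, e, ← add_mul, ← C_add]
    congr 2
    push_cast
    ring

/-- The Hermite polynomials have no multiple zeros. -/
theorem eval_derivative_physHermite_ne_zero (n : ℕ) (x : ℝ) (hx : (physHermite n).eval x = 0) :
    (derivative (physHermite n)).eval x ≠ 0 := by
  induction n with
  | zero => simp [physHermite] at hx
  | succ n ih =>
    intro h
    rw [derivative_physHermite_succ, eval_mul, eval_C] at h
    have h0 : (physHermite n).eval x = 0 := by
      rcases mul_eq_zero.1 h with h | h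
      · exact absurd h (by positivity)
      · exact h
    -- A double zero of `H_{n+1}` is a zero of `H_n`, hence by the recurrence also of `H_n'`;
    -- descent ends at `H_0 = 1`.
    refine ih h0 ?_
    simpa [physHermite_succ, h0] using hx

theorem integrable_exp_neg_sq_mul_eval (p : ℝ[X]) :
    Integrable fun t : ℝ => Real.exp (-t ^ 2) * p.eval t := by
  simp only [eval_eq_sum, Polynomial.sum, Finset.mul_sum]
  refine integrable_finsetSum _ fun k _ => ?_
  have h := (integrable_rpow_mul_exp_neg_mul_sq one_pos
    (s := k) (by have := k.cast_nonneg (α := ℝ); linarith)).const_mul (p.coeff k)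
  refine h.congr (.of_forall fun t => ?_)
  simp only [Real.rpow_natCast, neg_mul, one_mul]
  ring

/-- Integration by parts: `H_{n+1} exp (-t²)` is minus the derivative of `H_n exp (-t²)`, and the
boundary terms vanish by integrability. -/
theorem integral_physHermite_succ_mul (n : ℕ) (q : ℝ[X]) :
    ∫ t : ℝ, Real.exp (-t ^ 2) * (physHermite (n + 1) * q).eval t =
      ∫ t : ℝ, Real.exp (-t ^ 2) * (physHermite n * derivative q).eval t := by
  have hder : ∀ t : ℝ, HasDerivAt (fun t => Real.exp (-t ^ 2) * (physHermite n * q).eval t)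
      (Real.exp (-t ^ 2) * (physHermite n * derivative q - physHermite (n + 1) * q).eval t) t := by
    intro t
    have h := ((hasDerivAt_pow 2 t).neg.exp).mul ((physHermite n * q).hasDerivAt t)
    refine h.congr_deriv ?_
    simp only [physHermite_succ, derivative_mul, eval_add, eval_sub, eval_mul, eval_C, eval_X]
    norm_num
    ring
  have h0 := integral_eq_zero_of_hasDerivAt_of_integrable hder
    (integrable_exp_neg_sq_mul_eval _) (integrable_exp_neg_sq_mul_eval _)
  simp only [eval_sub, mul_sub] at h0
  rw [integral_sub (integrable_exp_neg_sq_mul_eval _) (integrable_exp_neg_sq_mul_eval _)] at h0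
  linarith

/-- The Hermite polynomial of degree `n` is orthogonal to all polynomials of lower degree. -/
theorem integral_physHermite_mul_eq_zero (n : ℕ) (q : ℝ[X]) (hq : q.degree < n) :
    ∫ t : ℝ, Real.exp (-t ^ 2) * (physHermite n * q).eval t = 0 := by
  induction n generalizing q with
  | zero =>
    have : q = 0 := by simpa using hq
    simp [this]
  | succ n ih =>
    rw [integral_physHermite_succ_mul]
    refine ih _ ?_
    rcases eq_or_ne q 0 with rfl | h0
    · simp
    · have h1 := degree_derivative_lt h0
      rw [degree_eq_natDegree h0] at h1 hq
      have h2 : q.natDegree ≤ n := by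
        have : q.natDegree < n + 1 := by exact_mod_cast hq
        omega
      exact h1.trans_le (by exact_mod_cast h2)

theorem integral_exp_neg_sq_mul_eval_ne_zero {p : ℝ[X]} (hp : p ≠ 0) (h : ∀ t, 0 ≤ p.eval t) :
    ∫ t : ℝ, Real.exp (-t ^ 2) * p.eval t ≠ 0 := by
  have hc : Continuous fun t : ℝ => Real.exp (-t ^ 2) * p.eval t := by fun_prop
  obtain ⟨x, hx⟩ : ∃ x, p.eval x ≠ 0 := by
    by_contra! hcon
    exact hp (Polynomial.funext (by simpa using hcon))
  exact (integral_pos_of_integrable_nonneg_nonzero hc (integrable_exp_neg_sq_mul_eval p)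
    (fun t => mul_nonneg (Real.exp_pos _).le (h t))
    (mul_ne_zero (Real.exp_pos (-x ^ 2)).ne' hx)).ne'

/-- All zeros are simple. If fewer than `n` were real, write `H_n = r q` with `r` carrying the real
zeros and `q` of constant sign; then `∫ exp (-t²) H_n r = ∫ exp (-t²) r² q ≠ 0` contradicts
orthogonality, as `deg r < n`. -/
theorem card_ghNodes (n : ℕ) : (ghNodes n).card = n := by
  have hnodup : (physHermite n).roots.Nodup := by
    rw [Multiset.nodup_iff_count_le_one]
    intro x
    rw [count_roots]
    by_contra! h
    have h1 := (one_lt_rootMultiplicity_iff_isRoot (physHermite_ne_zero n)).1 h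
    exact eval_derivative_physHermite_ne_zero n x h1.1 h1.2
  rw [ghNodes, Multiset.toFinset_card_of_nodup hnodup]
  obtain ⟨q, hq, hdeg, hroots⟩ := exists_prod_multiset_X_sub_C_mul (physHermite n)
  have hnat : (physHermite n).natDegree = n := natDegree_eq_of_degree_eq_some (degree_physHermite n)
  set r : ℝ[X] := ((physHermite n).roots.map fun a => X - C a).prod with hr
  by_contra hne
  have hlt : (physHermite n).roots.card < n := by omega
  have hrdeg : r.degree < n := by
    rw [hr, degree_eq_natDegree (Multiset.prod_ne_zero (by simp [X_sub_C_ne_zero])),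
      natDegree_multiset_prod_X_sub_C_eq_card]
    exact_mod_cast hlt
  have h0 := integral_physHermite_mul_eq_zero n r hrdeg
  have hq0 : q ≠ 0 := by
    rintro rfl
    exact physHermite_ne_zero n (by rw [← hq, mul_zero])
  have hr0 : r ≠ 0 := by
    intro h
    exact physHermite_ne_zero n (by rw [← hq, h, zero_mul])
  have hqne : ∀ t, q.eval t ≠ 0 := fun t ht => by
    have : t ∈ q.roots := (mem_roots hq0).2 ht
    simp [hroots] at this
  have hqc : Continuous fun t => q.eval t := q.continuous
  have hprod : physHermite n * r = r ^ 2 * q := by rw [← hq]; ring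
  rw [hprod] at h0
  have hsign : (∀ t, 0 ≤ q.eval t) ∨ ∀ t, 0 ≤ (-q).eval t := by
    by_contra! hcon
    obtain ⟨⟨a, ha⟩, b, hb⟩ := hcon
    rw [eval_neg, neg_lt_zero] at hb
    obtain ⟨t, ht⟩ := mem_range_of_exists_le_of_exists_ge hqc ⟨a, ha.le⟩ ⟨b, hb.le⟩
    exact hqne t ht
  rcases hsign with h | h
  · refine integral_exp_neg_sq_mul_eval_ne_zero (mul_ne_zero (pow_ne_zero 2 hr0) hq0)
      (fun t => ?_) h0
    rw [eval_mul, eval_pow]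
    exact mul_nonneg (sq_nonneg _) (h t)
  · refine integral_exp_neg_sq_mul_eval_ne_zero (p := r ^ 2 * -q)
      (mul_ne_zero (pow_ne_zero 2 hr0) (neg_ne_zero.2 hq0)) (fun t => ?_) ?_
    · rw [eval_mul, eval_pow]
      exact mul_nonneg (sq_nonneg _) (h t)
    · simp only [mul_neg, eval_neg, integral_neg, h0, neg_zero]

/-- With `n` distinct nodes, `p` equals its Lagrange interpolant, and the weights are the integrals
of the basis polynomials. -/
theorem integral_eq_sum_ghWeight_of_degree_lt (n : ℕ) (p : ℝ[X]) (hp : p.degree < n) :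
    ∫ t : ℝ, Real.exp (-t ^ 2) * p.eval t = ∑ x ∈ ghNodes n, ghWeight n x * p.eval x := by
  have h := Lagrange.eq_interpolate (s := ghNodes n) (v := id) (f := p)
    Function.injective_id.injOn (by rwa [card_ghNodes])
  rw [Lagrange.interpolate_apply] at h
  have hev : ∀ t : ℝ, Real.exp (-t ^ 2) * p.eval t =
      ∑ x ∈ ghNodes n, p.eval x * (Real.exp (-t ^ 2) * (Lagrange.basis (ghNodes n) id x).eval t) := by
    intro t
    conv_lhs => rw [h]
    simp only [eval_finsetSum, eval_mul, eval_C, Finset.mul_sum, id]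
    exact Finset.sum_congr rfl fun x _ => by ring
  simp only [hev]
  rw [integral_finsetSum _ fun x _ => (integrable_exp_neg_sq_mul_eval _).const_mul _]
  refine Finset.sum_congr rfl fun x _ => ?_
  rw [integral_const_mul, mul_comm]
  rfl

/-- The Gauss–Hermite rule with `n` points is exact up to degree `2 n - 1`. -/
theorem integral_eq_sum_ghWeight (n : ℕ) (p : ℝ[X]) (hp : p.degree < (2 * n : ℕ)) :
    ∫ t : ℝ, Real.exp (-t ^ 2) * p.eval t = ∑ x ∈ ghNodes n, ghWeight n x * p.eval x := by
  have hH := physHermite_ne_zero n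
  -- Divide by `H_n`: the quotient part integrates to zero by orthogonality and vanishes at the
  -- nodes, and the remainder is integrated by interpolation.
  have hmod : (p % physHermite n).degree < n := by
    rw [← degree_physHermite n]
    exact EuclideanDomain.mod_lt p hH
  have hdiv : (p / physHermite n).degree < n := by
    by_cases hlt : p.degree < (physHermite n).degree
    · rw [(Polynomial.div_eq_zero_iff hH).2 hlt]
      simp
    · have h1 := degree_add_div hH (not_lt.1 hlt)
      rw [← h1, degree_physHermite, two_mul, Nat.cast_add] at hp
      exact lt_of_add_lt_add_left hp
  have hsplit : ∀ t, p.eval t = (physHermite n * (p / physHermite n)).eval t +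
      (p % physHermite n).eval t := fun t => by
    rw [← eval_add, EuclideanDomain.div_add_mod]
  calc ∫ t : ℝ, Real.exp (-t ^ 2) * p.eval t
      = ∫ t : ℝ, (Real.exp (-t ^ 2) * (physHermite n * (p / physHermite n)).eval t +
          Real.exp (-t ^ 2) * (p % physHermite n).eval t) := by simp only [hsplit, mul_add]
    _ = ∑ x ∈ ghNodes n, ghWeight n x * (p % physHermite n).eval x := by
        rw [integral_add (integrable_exp_neg_sq_mul_eval _) (integrable_exp_neg_sq_mul_eval _),
          integral_physHermite_mul_eq_zero n _ hdiv, zero_add,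
          integral_eq_sum_ghWeight_of_degree_lt n _ hmod]
    _ = _ := by
        refine Finset.sum_congr rfl fun x hx => ?_
        have hx0 : (physHermite n).eval x = 0 := (mem_roots hH).1 (Multiset.mem_toFinset.1 hx)
        rw [hsplit x, eval_mul, hx0, zero_mul, zero_add]

theorem integral_exp_neg_norm_sq_mul_prod {d : ℕ} (f : Fin d → ℝ → ℝ) :
    ∫ x : E d, Real.exp (-‖x‖ ^ 2) * ∏ r, f r (x r) =
      ∏ r, ∫ t : ℝ, Real.exp (-t ^ 2) * f r t := by
  rw [← (PiLp.volume_preserving_toLp (Fin d)).integral_comp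
    (MeasurableEquiv.toLp 2 (Fin d → ℝ)).measurableEmbedding,
    ← integral_fintype_prod_volume_eq_prod]
  refine integral_congr_ae (.of_forall fun x => ?_)
  simp only [EuclideanSpace.real_norm_sq_eq, ← Finset.sum_neg_distrib, Real.exp_sum,
    Finset.prod_mul_distrib]

/-- The tensor-product Gauss–Hermite rule with `n` points per dimension is exact for polynomials of
total degree at most `2 n - 1`. -/
theorem integral_eq_sum_ghGridWeight {d D n : ℕ} (hn : D + 1 ≤ 2 * n)
    (p : MvPolynomial (Fin d) ℝ) (hp : p.totalDegree ≤ D) :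
    ∫ x : E d, Real.exp (-‖x‖ ^ 2) * MvPolynomial.eval x.ofLp p =
      ∑ y ∈ ghGrid d n, ghGridWeight n y * MvPolynomial.eval y p := by
  -- Every exponent of a monomial is at most `D ≤ 2n - 1`, so the one-dimensional rule applies in
  -- each coordinate; multiplying out the sums gives the grid. The form `D + 1 ≤ 2 * n` avoids
  -- truncated subtraction at `n = 0`.
  have hmono : ∀ s ∈ p.support, ∫ x : E d, Real.exp (-‖x‖ ^ 2) * ∏ r, x r ^ s r =
      ∑ y ∈ ghGrid d n, ghGridWeight n y * ∏ r, y r ^ s r := by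
    intro s hs
    rw [integral_exp_neg_norm_sq_mul_prod fun r t => t ^ s r]
    have h1 : ∀ r, ∫ t : ℝ, Real.exp (-t ^ 2) * t ^ s r =
        ∑ x ∈ ghNodes n, ghWeight n x * x ^ s r := by
      intro r
      have hsr : s r ≤ D :=
        (Finsupp.le_degree r s).trans ((MvPolynomial.le_totalDegree hs).trans hp)
      have := integral_eq_sum_ghWeight n (X ^ s r) (by
        rw [degree_X_pow]
        exact_mod_cast (by omega : s r < 2 * n))
      simpa using this
    simp only [h1]
    rw [Finset.prod_univ_sum]
    simp only [Finset.prod_mul_distrib]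
    rfl
  have hint : ∀ s : Fin d →₀ ℕ,
      Integrable fun x : E d => Real.exp (-‖x‖ ^ 2) * ∏ r, x r ^ s r := by
    intro s
    rw [← (PiLp.volume_preserving_toLp (Fin d)).integrable_comp_emb
      (MeasurableEquiv.toLp 2 (Fin d → ℝ)).measurableEmbedding]
    have := Integrable.fintype_prod (𝕜 := ℝ) (μ := fun _ : Fin d => (volume : Measure ℝ))
      (f := fun r t => Real.exp (-t ^ 2) * t ^ s r) fun r => by
        simpa using integrable_exp_neg_sq_mul_eval (X ^ s r)
    refine this.congr (.of_forall fun x => ?_)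
    simp only [Function.comp_apply, EuclideanSpace.real_norm_sq_eq, ← Finset.sum_neg_distrib,
      Real.exp_sum, Finset.prod_mul_distrib]
  simp only [MvPolynomial.eval_eq', Finset.mul_sum, mul_left_comm _ (p.coeff _)]
  rw [integral_finsetSum _ fun s _ => (hint s).const_mul _, Finset.sum_comm]
  refine Finset.sum_congr rfl fun s hs => ?_
  rw [integral_const_mul, hmono s hs, Finset.mul_sum]

end GRBF

/-! ### The main theorem -/

theorem mainTheorem2 {d L α β : ℕ} (hαβ : 0 < α + β)
    (m : Fin L → GRBF.E d) (C : Fin L → Matrix (Fin d) (Fin d) ℝ)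
    (hC : ∀ l, (C l).PosDef)
    (i : Fin α → Fin L) (j : Fin β → Fin L)
    (mbar : GRBF.E d) (Cbar : Matrix (Fin d) (Fin d) ℝ) (Z : ℝ)
    (hmbar : mbar = GRBF.prodMean (fun s => m (Sum.elim i j s)) (fun s => C (Sum.elim i j s)))
    (hCbar : Cbar = GRBF.prodCov (fun s => C (Sum.elim i j s)))
    (hZ : Z = GRBF.prodConst (fun s => m (Sum.elim i j s)) (fun s => C (Sum.elim i j s)))
    {Ω : Type*} [MeasurableSpace Ω] (P : MeasureTheory.Measure Ω) (X : Ω → GRBF.E d)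
    (hX : ProbabilityTheory.HasLaw X (ProbabilityTheory.multivariateGaussian mbar Cbar) P) :
    -- `Z` and the Gaussian density of `X` are those of the product density
    (∀ x, (∏ a, GRBF.gauss (m (i a)) (C (i a)) x) * (∏ b, GRBF.gauss (m (j b)) (C (j b)) x) =
      Z * GRBF.gauss mbar Cbar x) ∧
    -- the integral and the tensor moments exist
    MeasureTheory.Integrable (GRBF.integrand m C i j) MeasureTheory.volume ∧
    (∀ k : ℕ, MeasureTheory.Integrable (fun w => GRBF.tensorPow (X w) k) P) ∧
    -- the closed form
    (∫ x, GRBF.integrand m C i j x) =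
      Z • ∑ J : Finset (Fin β), (-1 : ℝ) ^ (β - J.card) •
        GRBF.evenContract (GRBF.outerMat fun b => (C (j b))⁻¹)
          (GRBF.permute (GRBF.sigma J)
            (GRBF.tensorMul
              (GRBF.outerVec fun r : Fin J.card => m (j (J.orderEmbOfFin rfl r)))
              (∫ w, GRBF.tensorPow (X w) (β - J.card) ∂P))) ∧
    -- the quadrature form, where `R` is the Cholesky factor of the covariance of `X`
    (∀ R : Matrix (Fin d) (Fin d) ℝ, GRBF.IsCholeskyFactor R Cbar →
      -- for every rule that is exact up to degree `β`
      (∀ (N : ℕ) (_ : 1 ≤ N) (y : Fin N → GRBF.E d) (ω : Fin N → ℝ),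
        GRBF.IsExactHermiteRule β y ω →
        (∫ x, GRBF.integrand m C i j x) =
          (Z * Real.pi ^ (-(d : ℝ) / 2)) • ∑ k, ω k •
            GRBF.polyTensor m C j (Real.sqrt 2 • GRBF.mulE R (y k) + mbar)) ∧
      -- and for the tensor-product rule with `n` points per dimension, `β ≤ 2n - 1`
      (∀ n : ℕ, β + 1 ≤ 2 * n →
        (∫ x, GRBF.integrand m C i j x) =
          (Z * Real.pi ^ (-(d : ℝ) / 2)) • ∑ y ∈ GRBF.ghGrid d n, GRBF.ghGridWeight n y •
            GRBF.polyTensor m C j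
              (Real.sqrt 2 • GRBF.mulE R (WithLp.toLp 2 y) + mbar))) := by

  -- With at least one factor, the sum of precisions is positive definite.
  have hne : Nonempty (Fin α ⊕ Fin β) := by
    rw [← Fintype.card_pos_iff]
    simpa using hαβ
  have hCpos : Cbar.PosDef := hCbar ▸ GRBF.posDef_prodCov fun s => hC _
  have hprod : ∀ x, (∏ a, GRBF.gauss (m (i a)) (C (i a)) x) *
      (∏ b, GRBF.gauss (m (j b)) (C (j b)) x) = Z * GRBF.gauss mbar Cbar x := by
    intro x
    rw [hZ, hmbar, hCbar]
    exact GRBF.prod_mul_prod_gauss hαβ m C hC i j x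
  have heq : GRBF.integrand m C i j =
      fun x => Z • GRBF.gauss mbar Cbar x • GRBF.polyTensor m C j x := by
    funext x
    rw [GRBF.integrand_eq_smul_polyTensor m C hC, hprod, smul_smul]
  have hI : ∫ x, GRBF.integrand m C i j x =
      Z • ∫ x, GRBF.polyTensor m C j x ∂(ProbabilityTheory.multivariateGaussian mbar Cbar) := by
    rw [heq, MeasureTheory.integral_smul, GRBF.integral_multivariateGaussian mbar hCpos]
  have hmom : ∀ k : ℕ, MeasureTheory.Integrable (fun x : GRBF.E d => GRBF.tensorPow x k)
      (P.map X) := fun k => by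
    rw [hX.map_eq]
    exact GRBF.integrable_tensorPow k _
  refine ⟨hprod, ?_, fun k => ?_, ?_, fun R hR => ?_⟩
  · rw [heq]
    exact ((GRBF.integrable_multivariateGaussian_iff mbar hCpos).1
      (GRBF.integrable_polyTensor m C j _)).smul Z
  · exact (hmom k).comp_aemeasurable hX.aemeasurable
  · have hlaw : ∀ k : ℕ, ∫ w, GRBF.tensorPow (X w) k ∂P =
        ∫ x, GRBF.tensorPow x k ∂(ProbabilityTheory.multivariateGaussian mbar Cbar) := fun k => by
      rw [← hX.map_eq, MeasureTheory.integral_map hX.aemeasurable (hmom k).1]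
    simp only [hlaw]
    rw [hI, GRBF.integral_polyTensor]
  -- The index type stays free so that one statement serves both `Fin N` and the grid.
  · have hquad := fun {κ : Type} => GRBF.integral_polyTensor_eq_quadrature (κ := κ) m C j mbar R
    rw [hR.mul_transpose] at hquad
    refine ⟨fun N _ y ω h => ?_, fun n hn => ?_⟩
    · rw [hI, hquad Finset.univ y ω h, smul_smul]
    · rw [hI, hquad (GRBF.ghGrid d n) (WithLp.toLp 2) (GRBF.ghGridWeight n)
        (GRBF.integral_eq_sum_ghGridWeight hn), smul_smul]
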